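/- A regular $\star$-semigroup is a semigroup $(S,\cdot)$ with a unary operation $\ast$ such that $xx^\ast x=x$, $(x^{\ast})^{\ast}=x$ and $(xy)^\ast=y^\ast x^\ast$ for all $x,y\in S$. A dual weak left $\star$-brace is a set $S$ with two such structures $(S,+,-)$ and $(S,\cdot,\ast)$ (the addition need not be commutative) such that, for all $x,y,w\in S$, $$x(y+w)=xy-x+xw,\qquad -x+x=xx^\ast,\qquad x-x=x^\ast x,$$ where multiplication has higher precedence than addition and negation, and $x-y$ means $x+(-y)$. Let $S$ be a dual weak left $\star$-brace and put $$\mathcal D_r(S)=\{z\in S\mid (a+b)z=az-z+bz\text{ for all }a,b\in S\}.$$ For $z\in S$ define maps $r_z,\check r_z:S\times S\to S\times S$ by $$r_z(a,b)=\bigl(\sigma,\ \sigma^\ast ab\bigr),\qquad \sigma=z^\ast z\,(-az+abz)\,z^\ast z,$$ $$\check r_z(a,b)=\bigl((ab-az+z)zz^\ast,\ ((ab-az+z)zz^\ast)^\ast ab\bigr).$$ **Theorem.** Let $z\in\mathcal D_r(S)$. Then $\check r_z$ is a set-theoretic solution of the Yang–Baxter equation, i.e. $$(\check r_z\times\mathrm{id}_S)(\mathrm{id}_S\times\check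 r_z)(\check r_z\times\mathrm{id}_S)=(\mathrm{id}_S\times\check r_z)(\check r_z\times\mathrm{id}_S)(\mathrm{id}_S\times\check r_z)$$ as maps $S\times S\times S\to S\times S\times S$. Moreover, with respect to composition of maps, $$r_z\,\check r_{z^\ast}\,r_z=r_z,\qquad \check r_{z^\ast}\,r_z\,\check r_{z^\ast}=\check r_{z^\ast},\qquad r_z\,\check r_{z^\ast}=\check r_{z^\ast}\,r_z.$$ -/

import Mathlib

/-- A regular `⋆`-semigroup, written multiplicatively. -/
class RegularStarSemigroup (S : Type*) extends Semigroup S, Star S where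
  mul_star_mul_self : ∀ x : S, x * star x * x = x
  star_star_self : ∀ x : S, star (star x) = x
  star_mul_rev : ∀ x y : S, star (x * y) = star y * star x

/-- A regular `⋆`-semigroup, written additively, with the unary operation denoted `-`.
The addition is not assumed to be commutative. -/
class AddRegularStarSemigroup (S : Type*) extends AddSemigroup S, Neg S where
  add_neg_add_self : ∀ x : S, x + -x + x = x
  neg_neg_self : ∀ x : S, - -x = x
  neg_add_rev_self : ∀ x y : S, -(x + y) = -y + -x

/-- A weak left `⋆`-brace. -/
class WeakLeftStarBrace (S : Type*) extends AddRegularStarSemigroup S, RegularStarSemigroup S where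
  mul_add_brace : ∀ x y z : S, x * (y + z) = x * y + -x + x * z
  neg_add_eq_mul_star : ∀ x : S, -x + x = x * star x

/-- A dual weak left `⋆`-brace. -/
class DualWeakLeftStarBrace (S : Type*) extends WeakLeftStarBrace S where
  add_neg_eq_star_mul : ∀ x : S, x + -x = star x * x

/-- The set of right distributors. -/
def rightDistributors (S : Type*) [DualWeakLeftStarBrace S] : Set S :=
  {z | ∀ a b : S, (a + b) * z = a * z + -z + b * z}

/-- The deformed map `r_z`. -/
def deformedMap {S : Type*} [DualWeakLeftStarBrace S] (z : S) : S × S → S × S :=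
  fun p =>
    let s := star z * z * (-(p.1 * z) + p.1 * p.2 * z) * (star z * z)
    (s, star s * (p.1 * p.2))

/-- The deformed map `ř_z`. -/
def checkDeformedMap {S : Type*} [DualWeakLeftStarBrace S] (z : S) : S × S → S × S :=
  fun p =>
    let s := (p.1 * p.2 + -(p.1 * z) + z) * (z * star z)
    (s, star s * (p.1 * p.2))

/-- The map `r × id` on `S × S × S`. -/
def actLeft {S : Type*} (r : S × S → S × S) : S × S × S → S × S × S :=
  fun p => ((r (p.1, p.2.1)).1, (r (p.1, p.2.1)).2, p.2.2)

/-- The map `id × r` on `S × S × S`. -/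
def actRight {S : Type*} (r : S × S → S × S) : S × S × S → S × S × S :=
  fun p => (p.1, r p.2)

/-- `r` is a set-theoretic solution of the Yang–Baxter equation. -/
def IsYangBaxterSolution {S : Type*} (r : S × S → S × S) : Prop :=
  actLeft r ∘ actRight r ∘ actLeft r = actRight r ∘ actLeft r ∘ actRight r

/-!
The proof reduces every identity to one in skew left braces, where it is a short computation
in two groups.

Call `e` a projection if `e * e = e` and `star e = e`. The additive and the multiplicative
projections coincide, and comparing the two natural partial orders on them shows that
`e * y = y + e` and `y * e = e + y` for every projection `e` and every element `y`
(`IsProjection.mul_eq_add`, `IsProjection.mul_eq_add'`). Left distributivity then becomes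
`e * w * f = e * w * e * f` for projections `e`, `f` (`proj_mul_mul_proj`). Hence projections move
freely in the interior of a product (`mul_proj_comm_mul`), and the two projections `x * star x`
and `star x * x` of an element generate each other (`star_mul_mul_star_proj`).

It follows that the `𝒟`-classes form a semilattice; `LiesBelow e x` expresses that the class
of the projection `e` is below that of `x`. The `ℋ`-class of `e` is a skew left brace, and
`x ↦ e * x * e` respects both operations on the elements above `e` (`HClass.core`). An element is
determined by its `𝒟`-class, its compressions, and any factors `f`, `g` with `f * x = x` and
`x * g = x` (`eq_of_core_eq`). Both sides of each required identity agree in their `𝒟`-class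
and in such factors, for example `z * star z` and `star c * c`, so only their compressions matter.

In a skew left brace with right distributor `z`, put `σ_a b = a * b - a * z + z`. Since
`σ_a (σ_b c) = a * b * c - a * b * z + z` depends only on `a * b`, the first components in the
Yang-Baxter equation agree; right distributivity gives the second ones, and the third ones follow
as both sides preserve the triple product (`deformedAct_yangBaxter`). Moreover `z⁻¹` is again a
right distributor, and the deformed map for `z` and the check-deformed map for `z⁻¹` are inverse to
each other, which yields the three remaining identities.
-/

section StarSemigroup

/-! ### Projections of regular `⋆`-semigroups -/

variable {S : Type*} [RegularStarSemigroup S]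

/-- A projection: an idempotent fixed by the involution. -/
structure IsProjection (e : S) : Prop where
  mul_self : e * e = e
  star_eq : star e = e

open RegularStarSemigroup

theorem mul_star_mul_self_assoc (x : S) : x * (star x * x) = x := by
  rw [← mul_assoc, mul_star_mul_self]

theorem star_mul_mul_star (x : S) : star x * x * star x = star x := by
  simpa [star_star_self] using mul_star_mul_self (star x)

theorem isProjection_mul_star (x : S) : IsProjection (x * star x) where
  mul_self := by rw [← mul_assoc, mul_star_mul_self]
  star_eq := by rw [star_mul_rev, star_star_self]

theorem isProjection_star_mul (x : S) : IsProjection (star x * x) where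
  mul_self := by rw [← mul_assoc, star_mul_mul_star]
  star_eq := by rw [star_mul_rev, star_star_self]

theorem IsProjection.mul_left_self {e : S} (he : IsProjection e) (x : S) :
    e * (e * x) = e * x := by rw [← mul_assoc, he.mul_self]

theorem IsProjection.conj {e : S} (he : IsProjection e) (x : S) :
    IsProjection (x * e * star x) := by
  have h := isProjection_mul_star (x * e)
  rwa [star_mul_rev, he.star_eq, ← mul_assoc, mul_assoc x, he.mul_self] at h

theorem IsProjection.conj_proj {e f : S} (he : IsProjection e) (hf : IsProjection f) :
    IsProjection (e * f * e) := by
  simpa [he.star_eq] using hf.conj e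

end StarSemigroup

section Brace

/-! ### Projections of dual weak left `⋆`-braces -/

variable {S : Type*} [DualWeakLeftStarBrace S]

open RegularStarSemigroup AddRegularStarSemigroup WeakLeftStarBrace DualWeakLeftStarBrace

theorem add_mul_star (x : S) : x + x * star x = x := by
  rw [← neg_add_eq_mul_star, ← add_assoc, add_neg_add_self]

theorem star_mul_add (x : S) : star x * x + x = x := by
  rw [← add_neg_eq_star_mul, add_neg_add_self]

theorem neg_add_neg_self (x : S) : -x + x + -x = -x := by
  simpa [neg_neg_self] using add_neg_add_self (-x)

namespace IsProjection

variable {e f g : S}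

theorem neg_add (he : IsProjection e) : -e + e = e := by
  rw [neg_add_eq_mul_star, he.star_eq, he.mul_self]

theorem neg_eq (he : IsProjection e) : -e = e := by
  conv_lhs => rw [← he.neg_add, neg_add_rev_self, neg_neg_self, he.neg_add]

theorem add_self (he : IsProjection e) : e + e = e := by
  conv_lhs => enter [1]; rw [← he.neg_eq]
  exact he.neg_add

theorem add_left_self (he : IsProjection e) (x : S) : e + (e + x) = e + x := by
  rw [← add_assoc, he.add_self]

theorem mul_add' (he : IsProjection e) (x y : S) : e * (x + y) = e * x + (e + e * y) := by
  rw [mul_add_brace, he.neg_eq, add_assoc]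

/-- The multiplicative order on projections is contained in the additive one. -/
theorem add_of_mul (he : IsProjection e) (hg : IsProjection g) (h₁ : e * g = g)
    (h₂ : g * e = g) : e + g = g ∧ g + e = g := by
  have hgeg : g + (e + g) = g := by
    have := he.mul_add' g g
    rw [hg.add_self, h₁] at this
    exact this.symm
  have hneg : -(e + g) = g + e := by rw [neg_add_rev_self, he.neg_eq, hg.neg_eq]
  have hp : (e + g) * star (e + g) = g := by
    rw [← neg_add_eq_mul_star, hneg, add_assoc, he.add_left_self, hgeg]
  have hgp : g * (e + g) = e + g := by
    conv_lhs => enter [1]; rw [← hp]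
    exact mul_star_mul_self _
  have h3 : g * (e + (g + e)) = e + g := by
    rw [← add_assoc, hg.mul_add', hgp, h₂, hg.add_self, add_assoc, hg.add_self]
  have h4 : g * (e + (e + (g + e))) = g + (e + g) := by
    rw [hg.mul_add', h₂, h3, hg.add_left_self]
  rw [he.add_left_self, h3, hgeg] at h4
  refine ⟨h4, ?_⟩
  rw [← hneg, h4, hg.neg_eq]

theorem mul_mul_add (he : IsProjection e) (hf : IsProjection f) :
    e + e * f * e = e * f * e ∧ e * f * e + e = e * f * e := by
  refine he.add_of_mul (he.conj_proj hf) ?_ ?_ <;>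
    simp only [mul_assoc, he.mul_left_self, he.mul_self]

theorem mul_add_proj (he : IsProjection e) (x : S) : e * x + e = e * x := by
  conv_lhs => enter [1]; rw [← add_mul_star (e * x)]
  conv_rhs => rw [← add_mul_star (e * x)]
  rw [star_mul_rev, he.star_eq, show e * x * (star x * e) = e * (x * star x) * e by
    simp only [mul_assoc], add_assoc, (he.mul_mul_add (isProjection_mul_star x)).2]

/-- The additive order on projections is contained in the multiplicative one. -/
theorem mul_of_add (he : IsProjection e) (hg : IsProjection g) (h₁ : e + g = g)
    (h₂ : g + e = g) : e * g = g ∧ g * e = g := by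
  have h3 : g = g + g * e := by
    have := hg.mul_add' g e
    rwa [h₂, hg.mul_self, hg.add_left_self] at this
  have h4 : g * e + g = g := by
    have := hg.mul_add' e g
    rw [h₁, hg.mul_self, hg.add_self] at this
    exact this.symm
  have h5 : -(g * e) + (g * e) = g * e * g := by
    rw [neg_add_eq_mul_star, star_mul_rev, he.star_eq, hg.star_eq]
    simp only [mul_assoc, he.mul_left_self]
  have h6 : -(g * e) + g = g := by
    have := congrArg (fun x => -x) h3
    simp only [neg_add_rev_self, hg.neg_eq] at this
    exact this.symm
  have h7 : g * e * g = g := by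
    rw [← (hg.mul_mul_add he).2, ← h5, add_assoc, h4, h6]
  have h8 : g * e = g := by
    conv_lhs => rw [← add_neg_add_self (g * e)]
    rw [add_assoc, h5, h7, h4]
  refine ⟨?_, h8⟩
  have := congrArg star h8
  rwa [star_mul_rev, he.star_eq, hg.star_eq] at this

theorem add_add_proj (he : IsProjection e) (hf : IsProjection f) :
    IsProjection (e + f + e) := by
  have : e + f + e = (f + e) * star (f + e) := by
    rw [← neg_add_eq_mul_star, neg_add_rev_self, he.neg_eq, hf.neg_eq, add_assoc e f (f + e),
      hf.add_left_self, add_assoc]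
  rw [this]
  exact isProjection_mul_star _

theorem mul_add_add (he : IsProjection e) (hf : IsProjection f) :
    e * (e + f + e) = e + f + e := by
  refine (he.mul_of_add (he.add_add_proj hf) ?_ ?_).1
  · rw [← add_assoc, ← add_assoc, he.add_self]
  · rw [add_assoc, he.add_self]

/-- Left multiplication by a projection is right addition of it. -/
theorem mul_eq_add (he : IsProjection e) (y : S) : e * y = y + e := by
  have h1 : e * (y + e) = e * y := by
    rw [he.mul_add', he.mul_self, he.add_self, he.mul_add_proj]
  rw [← h1]
  have h2 : (y + e) * star (y + e) = e + y * star y + e := by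
    rw [← neg_add_eq_mul_star, ← neg_add_eq_mul_star, neg_add_rev_self, he.neg_eq]
    simp only [add_assoc]
  conv_lhs => rw [← mul_star_mul_self (y + e), h2, ← mul_assoc,
    he.mul_add_add (isProjection_mul_star y), ← h2, mul_star_mul_self]

end IsProjection

open IsProjection

/-- Right multiplication of `y` by a projection below `star y * y` is left addition of it. -/
theorem mul_eq_add_of_le {e : S} (he : IsProjection e) (y : S) (h₁ : star y * y * e = e)
    (h₂ : e * (star y * y) = e) : y * e = e + y := by
  have hf := isProjection_star_mul y
  have hp := isProjection_mul_star y
  have hadd := hf.add_of_mul he h₁ h₂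
  -- both `y * e` and `e + y` equal `y` plus their common left projection
  have hu : y + y * e * star y = y * e := by
    have h3 : -y + y * e = y * e * star y := by
      have := mul_add_brace y (star y) e
      rw [← neg_add_eq_mul_star, neg_add_neg_self, ← he.mul_eq_add, ← mul_assoc] at this
      exact this.symm
    have h4 : e + y * e = y * e := by
      have := star_mul_add (y * e)
      rwa [star_mul_rev, he.star_eq, mul_assoc, ← mul_assoc (star y), h₁, he.mul_self] at this
    rw [← h3, ← add_assoc, add_neg_eq_star_mul, ← h4, ← add_assoc, hadd.1]
  have hvg : (e + y) * star (e + y) = -y + (e + y) := by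
    rw [← neg_add_eq_mul_star, neg_add_rev_self, he.neg_eq, add_assoc, he.add_left_self]
  have hg : IsProjection (-y + (e + y)) := hvg ▸ isProjection_mul_star _
  have hv : y + (-y + (e + y)) = e + y := by
    rw [← add_assoc, add_neg_eq_star_mul, ← add_assoc, hadd.1]
  have hve : star (e + y) * (e + y) = e := by
    rw [← add_neg_eq_star_mul, neg_add_rev_self, he.neg_eq, add_assoc, ← add_assoc y,
      add_neg_eq_star_mul, hadd.1, he.add_self]
  have hgy : (-y + (e + y)) * y = e + y := by rw [hg.mul_eq_add, hv]
  rw [← hgy, star_mul_rev, hg.star_eq, mul_assoc, hg.mul_left_self, ← mul_assoc] at hve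
  have hle := hp.mul_of_add hg
    (by rw [← neg_add_eq_mul_star, ← add_assoc, neg_add_neg_self])
    (by simp only [add_assoc, add_mul_star])
  have hge : y * e * star y = -y + (e + y) := by
    calc y * e * star y = y * star y * ((-y + (e + y)) * (y * star y)) := by
          conv_lhs => rw [← hve]
          simp only [mul_assoc]
      _ = _ := by rw [hle.2, hle.1]
  rw [← hu, hge, hv]

/-- Right multiplication by a projection is left addition of it. -/
theorem IsProjection.mul_eq_add' {e : S} (he : IsProjection e) (y : S) : y * e = e + y := by
  have hf := isProjection_star_mul y
  set f := star y * y with hfdef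
  have hyf : y * f = y := mul_star_mul_self_assoc y
  have hfy : f + y = y := star_mul_add y
  have hefe : e * (f * e) = e + (f + e) := by
    rw [he.mul_eq_add, hf.mul_eq_add, add_assoc]
  have hfef : f * e * f = f + e + f := by
    rw [mul_assoc, hf.mul_eq_add, he.mul_eq_add]
  have hu : e + (f + (e + y * e)) = y * e := by
    have := star_mul_add (y * e)
    rwa [star_mul_rev, he.star_eq, mul_assoc, ← mul_assoc (star y), ← hfdef, hefe,
      add_assoc, add_assoc] at this
  have heu : e + y * e = y * e := by
    conv_lhs => rw [← hu, he.add_left_self, hu]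
  have hv : e + (f + (e + y)) = e + y := by
    have := add_neg_add_self (e + f)
    rw [neg_add_rev_self, he.neg_eq, hf.neg_eq] at this
    simp only [add_assoc, hf.add_left_self, he.add_left_self] at this
    have := congrArg (· + y) this
    simpa only [add_assoc, hfy] using this
  -- `f + y * e` and `f + (e + y)` are two expressions for `y * (e * f)`
  have hyef : f + y * e = f + (e + y) := by
    have h1 : y * (f * e * f) = f * e * f + y := by
      refine mul_eq_add_of_le (hf.conj_proj he) y ?_ ?_ <;>
        simp only [← hfdef, mul_assoc, hf.mul_left_self, hf.mul_self]
    have h2 := mul_add_brace y f e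
    rw [hyf, add_neg_eq_star_mul, ← he.mul_eq_add] at h2
    rw [← hfdef] at h2
    rw [← h2, ← hyf, mul_assoc, ← mul_assoc f, hyf, h1, hfef, add_assoc, add_assoc, hfy]
  rw [← hv, ← hyef]
  conv_lhs => rw [← hu, heu]

/-- This is the law `e * (f + w) = e * f - e + e * w`, after left and right multiplication by
projections have been rewritten as additions. -/
theorem proj_mul_mul_proj {e f : S} (he : IsProjection e) (hf : IsProjection f) (w : S) :
    e * w * f = e * w * e * f := by
  have h := he.mul_add' f w
  simp only [he.mul_eq_add, hf.mul_eq_add', he.mul_eq_add', add_assoc, he.add_left_self] at h ⊢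
  exact h

theorem proj_mul_mul_proj' {e f : S} (he : IsProjection e) (hf : IsProjection f) (w : S) :
    e * w * f = e * f * w * f := by
  have h := congrArg star (proj_mul_mul_proj hf he (star w))
  simpa only [star_mul_rev, star_star_self, he.star_eq, hf.star_eq, mul_assoc] using h

/-- Projections in the interior of a product may be moved freely. -/
theorem mul_proj_comm_mul {e : S} (he : IsProjection e) (a y b : S) :
    a * (e * (y * b)) = a * (y * (e * b)) := by
  -- both sides equal `a * e * y * e * b`
  have h1 := congrArg (· * b) (proj_mul_mul_proj he (isProjection_mul_star b) y)
  have h2 := congrArg (a * ·) (proj_mul_mul_proj' (isProjection_star_mul a) he y)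
  simp only [mul_assoc, mul_star_mul_self_assoc] at h1
  simp only [← mul_assoc, mul_star_mul_self] at h2
  rw [h1]
  simp only [← mul_assoc]
  rw [← h2]

/-- The two projections of an element generate each other: they lie in one `𝒟`-class. -/
theorem star_mul_mul_star_proj (y : S) :
    star y * y * (y * star y) * (star y * y) = star y * y := by
  have h := proj_mul_mul_proj (isProjection_mul_star y) (isProjection_star_mul y) y
  simp only [mul_assoc, mul_star_mul_self_assoc] at h ⊢
  exact congrArg (star y * ·) h.symm

theorem mul_star_star_mul_proj (y : S) :
    y * star y * (star y * y) * (y * star y) = y * star y := by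
  simpa [star_star_self] using star_mul_mul_star_proj (star y)

end Brace

section SkewBrace

/-! ### Skew left braces -/

variable {G : Type*} [Group G] [AddGroup G]

/-- The distributive law of a skew left brace, for a group that is also an additive group. -/
def IsSkewLeftBrace (G : Type*) [Group G] [AddGroup G] : Prop :=
  ∀ x y w : G, x * (y + w) = x * y + -x + x * w

/-- The law defining the right distributors of a skew left brace. -/
def IsRightDistributor (z : G) : Prop :=
  ∀ x y : G, (x + y) * z = x * z + -z + y * z

/-- The map `b ↦ a * b - a * z + z`, the first component of the deformed solution attached to
a parameter `z` of a skew left brace. -/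
def deformedAct (z a b : G) : G := a * b + -(a * z) + z

/-- In a skew left brace the additive identity is the multiplicative one. -/
theorem zero_eq_one_of_brace (hG : IsSkewLeftBrace G) : (0 : G) = 1 := by
  have h := hG 1 0 0
  simp only [one_mul, add_zero, zero_add] at h
  exact (neg_eq_zero.1 h.symm).symm

theorem mul_neg_of_brace (hG : IsSkewLeftBrace G) (x y : G) :
    x * -y = x + -(x * y) + x := by
  have h := hG x y (-y)
  rw [add_neg_cancel, zero_eq_one_of_brace hG, mul_one, ← neg_add_eq_iff_eq_add] at h
  rw [← h]
  simp [add_assoc]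

theorem mul_deformedAct (hG : IsSkewLeftBrace G) (z a b c : G) :
    a * deformedAct z b c = a * b * c + -(a * b * z) + a * z := by
  simp only [deformedAct, hG _ _, mul_neg_of_brace hG]
  simp [add_assoc, mul_assoc]

/-- The composite of the maps for `a` and `b` depends only on the product `a * b`. -/
theorem deformedAct_deformedAct (hG : IsSkewLeftBrace G)
    (z a b c : G) :
    deformedAct z a (deformedAct z b c) = a * b * c + -(a * b * z) + z := by
  rw [deformedAct, mul_deformedAct hG]
  simp [add_assoc]

variable {z : G}

theorem neg_mul_of_distrib (hG : IsSkewLeftBrace G) (hz : IsRightDistributor z)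
    (x : G) : -x * z = z + -(x * z) + z := by
  have h := hz x (-x)
  rw [add_neg_cancel, zero_eq_one_of_brace hG, one_mul, add_assoc, ← neg_add_eq_iff_eq_add] at h
  rw [add_assoc, h]
  simp

/-- Right distributors of a skew left brace are closed under inversion. -/
theorem IsRightDistributor.inv (hz : IsRightDistributor z) (hG : IsSkewLeftBrace G) :
    IsRightDistributor z⁻¹ := by
  intro x y
  rw [mul_inv_eq_iff_eq_mul, hz, hz, neg_mul_of_distrib hG hz]
  simp [← zero_eq_one_of_brace hG, add_assoc]

theorem deformedAct_mul (hG : IsSkewLeftBrace G) (hz : IsRightDistributor z)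
    (a b : G) :
    deformedAct z a b * z = a * b * z + -(a * z * z) + z * z := by
  simp only [deformedAct, hz _ _, neg_mul_of_distrib hG hz]
  simp [add_assoc]

/-- The second component of the Yang-Baxter equation, multiplied by the first one. Here
`(u, v)` and `(s, t)` are the images of `(a, b)` and `(b, c)`. -/
theorem deformedAct_middle (hG : IsSkewLeftBrace G) (hz : IsRightDistributor z)
    {a b c u v s t t' : G} (hu : u = deformedAct z a b) (huv : u * v = a * b)
    (hst : s * t = b * c) (ht' : deformedAct z a s * t' = a * s) :
    deformedAct z a s * deformedAct z t' t = u * deformedAct z v c := by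
  rw [mul_deformedAct hG, mul_deformedAct hG, huv, ht', deformedAct_mul hG hz, hu,
    deformedAct_mul hG hz, mul_assoc a s t, hst]
  simp [add_assoc, mul_assoc]

/-- The Yang-Baxter equation for the deformed solution of a skew left brace, written out
by components. -/
theorem deformedAct_yangBaxter (hG : IsSkewLeftBrace G) (hz : IsRightDistributor z)
    {a b c u v s t x y : G} (hu : u = deformedAct z a b) (hv : v = u⁻¹ * (a * b))
    (hs : s = deformedAct z b c) (ht : t = s⁻¹ * (b * c))
    (hx : x = deformedAct z a s) (hy : y = x⁻¹ * (a * s)) :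
    deformedAct z u (deformedAct z v c) = x ∧
    (deformedAct z u (deformedAct z v c))⁻¹ * (u * deformedAct z v c) = deformedAct z y t ∧
    (deformedAct z v c)⁻¹ * (v * c) = (deformedAct z y t)⁻¹ * (y * t) := by
  have huv : u * v = a * b := by rw [hv, mul_inv_cancel_left]
  have h1 : deformedAct z u (deformedAct z v c) = x := by
    rw [hx, hs, deformedAct_deformedAct hG, deformedAct_deformedAct hG, huv]
  have h2 : x * deformedAct z y t = u * deformedAct z v c := by
    have hst : s * t = b * c := by rw [ht, mul_inv_cancel_left]
    have hxy : deformedAct z a s * y = a * s := by rw [hy, hx, mul_inv_cancel_left]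
    rw [hx]
    exact deformedAct_middle hG hz hu huv hst hxy
  refine ⟨h1, by rw [h1, ← h2, inv_mul_cancel_left], ?_⟩
  rw [← inv_mul_eq_iff_eq_mul.2 h2.symm, hv, hy, ht]
  group

/-- Recovers `a` from the image of `(a, b)` under the deformed map for `z`, by means of the
check-deformed map for `z⁻¹`. -/
theorem deformedAct_inv_opposite (hG : IsSkewLeftBrace G) (hz : IsRightDistributor z)
    (a b : G) :
    deformedAct z⁻¹ (-(a * z) + a * b * z) ((-(a * z) + a * b * z)⁻¹ * (a * b)) = a := by
  have hzi := hz.inv hG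
  rw [deformedAct, hzi, neg_mul_of_distrib hG hzi]
  simp [add_assoc]

/-- Recovers `a` from the image of `(a, b)` under the check-deformed map for `z⁻¹`, by means of
the deformed map for `z`. -/
theorem opposite_deformedAct_inv (hG : IsSkewLeftBrace G) (hz : IsRightDistributor z)
    (a b : G) :
    -(deformedAct z⁻¹ a b * z) + a * b * z = a := by
  rw [deformedAct, hz, hz, neg_mul_of_distrib hG hz]
  simp [← zero_eq_one_of_brace hG, add_assoc]

end SkewBrace

section LiesBelow

/-! ### The semilattice of `𝒟`-classes -/

variable {S : Type*} [DualWeakLeftStarBrace S]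

open RegularStarSemigroup AddRegularStarSemigroup WeakLeftStarBrace DualWeakLeftStarBrace

/-- `LiesBelow e x` says that the projection `e` lies below `x` in the semilattice of
`𝒟`-classes: sandwiching the left projection of `x` between two copies of `e` gives back `e`. -/
def LiesBelow (e x : S) : Prop := e * (x * star x) * e = e

variable {e x y : S}

theorem liesBelow_self (x : S) : LiesBelow (x * star x) x := by
  simp only [LiesBelow, (isProjection_mul_star x).mul_self]

theorem liesBelow_star : LiesBelow e (star x) ↔ LiesBelow e x := by
  have hp := isProjection_mul_star x
  have hq := isProjection_star_mul x
  -- both conditions say that `e` is fixed by the same element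
  have h1 := mul_proj_comm_mul hp e (star x * x) (x * star x * e)
  have h2 := mul_proj_comm_mul hq e (x * star x) (star x * x * e)
  have h3 := mul_proj_comm_mul hp e (star x * x) e
  have h4 := star_mul_mul_star_proj x
  have h5 := mul_star_star_mul_proj x
  unfold LiesBelow
  rw [star_star_self]
  set p := x * star x
  set q := star x * x
  have h6 : e * (q * e) = e * (p * e) := by
    calc e * (q * e) = e * (q * p * q * e) := by rw [h4]
      _ = e * (p * (q * e)) := by
        rw [mul_assoc, mul_assoc, ← mul_proj_comm_mul hq, hq.mul_left_self, h3]
      _ = e * (p * (q * (p * e))) := by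
        rw [← mul_proj_comm_mul hp, hp.mul_left_self]
      _ = e * (p * q * p * e) := by simp only [mul_assoc]
      _ = e * (p * e) := by rw [h5]
  rw [mul_assoc e q, mul_assoc e p, h6]

theorem liesBelow_neg : LiesBelow e (-x) ↔ LiesBelow e x := by
  rw [← liesBelow_star (x := x), LiesBelow, LiesBelow, ← neg_add_eq_mul_star, neg_neg_self,
    star_star_self, add_neg_eq_star_mul]

theorem liesBelow_mul (he : IsProjection e) :
    LiesBelow e (x * y) ↔ LiesBelow e x ∧ LiesBelow e y := by
  have hp := isProjection_mul_star x
  have hr := isProjection_mul_star y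
  have h1 : e * (x * y * star (x * y)) * e = e * ((y * star y) * ((x * star x) * e)) := by
    have := mul_proj_comm_mul hr e x (star x * e)
    simp only [star_mul_rev, mul_assoc] at this ⊢
    exact this.symm
  unfold LiesBelow
  rw [h1]
  set p := x * star x
  set r := y * star y
  simp only [mul_assoc]
  constructor
  · intro h
    constructor
    · rw [← mul_proj_comm_mul hp] at h
      calc e * (p * e) = e * (p * (e * (p * (r * e)))) := by rw [h]
        _ = e * (p * (r * e)) := by
          rw [← mul_proj_comm_mul he, he.mul_left_self, hp.mul_left_self]
        _ = e := h
    · calc e * (r * e) = e * (r * (e * (r * (p * e)))) := by rw [h]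
        _ = e * (r * (p * e)) := by
          rw [← mul_proj_comm_mul he, he.mul_left_self, hr.mul_left_self]
        _ = e := h
  · rintro ⟨h2, h3⟩
    calc e * (r * (p * e)) = e * (r * (e * (p * e))) := by
          rw [← mul_proj_comm_mul he, he.mul_left_self]
      _ = e := by rw [h2, h3]

theorem liesBelow_add (he : IsProjection e) :
    LiesBelow e (x + y) ↔ LiesBelow e x ∧ LiesBelow e y := by
  rw [and_comm, ← liesBelow_mul he]
  unfold LiesBelow
  have h : (x + y) * star (x + y) = y * x * star (y * x) := by
    have hp := isProjection_mul_star x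
    rw [← neg_add_eq_mul_star, neg_add_rev_self, add_assoc, ← add_assoc (-x),
      neg_add_eq_mul_star, ← hp.mul_eq_add']
    have h2 := mul_add_brace y (star y) (x * star x)
    rw [← neg_add_eq_mul_star y, neg_add_neg_self, ← hp.mul_eq_add] at h2
    rw [← h2, star_mul_rev]
    simp only [mul_assoc]
  rw [h]

end LiesBelow

section HClass

/-! ### Compression to skew left braces -/

variable {S : Type*} [DualWeakLeftStarBrace S]

open RegularStarSemigroup AddRegularStarSemigroup WeakLeftStarBrace DualWeakLeftStarBrace

/-- The `ℋ`-class of a projection `e`. It is a skew left brace with identity `e`. -/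
@[ext]
structure HClass (e : {e : S // IsProjection e}) where
  /-- The underlying element. -/
  val : S
  mul_star : val * star val = e
  star_mul : star val * val = e

namespace HClass

variable {e : {e : S // IsProjection e}}

theorem e_mul (x : HClass e) : e * x.val = x.val := by
  rw [← x.mul_star, mul_star_mul_self]

theorem mul_e (x : HClass e) : x.val * e = x.val := by
  rw [← x.star_mul, mul_star_mul_self_assoc]

theorem add_e (x : HClass e) : x.val + e = x.val := by
  rw [← x.mul_star, add_mul_star]

theorem e_add (x : HClass e) : e + x.val = x.val := by
  rw [← x.star_mul, star_mul_add]

theorem neg_add (x : HClass e) : -x.val + x.val = e := by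
  rw [neg_add_eq_mul_star, x.mul_star]

theorem add_neg (x : HClass e) : x.val + -x.val = e := by
  rw [add_neg_eq_star_mul, x.star_mul]

instance : Mul (HClass e) where
  mul x y := ⟨x.val * y.val, by
    rw [star_mul_rev, mul_assoc, ← mul_assoc y.val, y.mul_star, ← mul_assoc, x.mul_e, x.mul_star],
    by rw [star_mul_rev, mul_assoc, ← mul_assoc _ x.val, x.star_mul, y.e_mul, y.star_mul]⟩

instance : One (HClass e) where
  one := ⟨e, by rw [e.2.star_eq, e.2.mul_self], by rw [e.2.star_eq, e.2.mul_self]⟩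

instance : Inv (HClass e) where
  inv x := ⟨star x.val, by rw [star_star_self, x.star_mul], by rw [star_star_self, x.mul_star]⟩

instance : Add (HClass e) where
  add x y := ⟨x.val + y.val, by
    rw [← neg_add_eq_mul_star, neg_add_rev_self, add_assoc, ← add_assoc _ x.val, x.neg_add,
      y.e_add, y.neg_add], by
    rw [← add_neg_eq_star_mul, neg_add_rev_self, add_assoc, ← add_assoc y.val, y.add_neg,
      ← add_assoc, x.add_e, x.add_neg]⟩

instance : Zero (HClass e) where
  zero := 1

instance : Neg (HClass e) where
  neg x := ⟨-x.val, by rw [← neg_add_eq_mul_star, neg_neg_self, x.add_neg],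
    by rw [← add_neg_eq_star_mul, neg_neg_self, x.neg_add]⟩

theorem val_mul (x y : HClass e) : (x * y).val = x.val * y.val := rfl
theorem val_inv (x : HClass e) : (x⁻¹).val = star x.val := rfl
theorem val_add (x y : HClass e) : (x + y).val = x.val + y.val := rfl
theorem val_neg (x : HClass e) : (-x).val = -x.val := rfl

instance : Group (HClass e) :=
  Group.ofLeftAxioms (fun _ _ _ => HClass.ext (mul_assoc _ _ _)) (fun x => HClass.ext x.e_mul)
    (fun x => HClass.ext x.star_mul)

instance : AddGroup (HClass e) :=
  AddGroup.ofLeftAxioms (fun _ _ _ => HClass.ext (add_assoc _ _ _))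
    (fun x => HClass.ext x.e_add) (fun x => HClass.ext x.neg_add)

theorem isSkewLeftBrace : IsSkewLeftBrace (HClass e) := fun _ _ _ =>
  HClass.ext (WeakLeftStarBrace.mul_add_brace _ _ _)

open Classical in
/-- The compression `x ↦ e * x * e` onto the `ℋ`-class of `e`. It takes values there
when `e` lies below `x`; outside that range it is given the value `1`. -/
noncomputable def core (e : {e : S // IsProjection e}) (x : S) : HClass e :=
  if h : LiesBelow e.1 x then
    ⟨e * x * e, by
      have h1 := mul_proj_comm_mul e.2 e.1 x (star x * e.1)
      unfold LiesBelow at h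
      simp only [star_mul_rev, e.2.star_eq, mul_assoc, e.2.mul_left_self] at h h1 ⊢
      rw [← h1, h], by
      have h1 := mul_proj_comm_mul e.2 e.1 (star x) (x * e.1)
      rw [← liesBelow_star, LiesBelow, star_star_self] at h
      simp only [star_mul_rev, e.2.star_eq, mul_assoc, e.2.mul_left_self] at h h1 ⊢
      rw [← h1, h]⟩
  else 1

variable {x y : S}

theorem val_core (h : LiesBelow e.1 x) : (core e x).val = e * x * e := by
  rw [core, dif_pos h]

theorem liesBelow (x : HClass e) : LiesBelow e.1 x.val := by
  rw [LiesBelow, x.mul_star, e.2.mul_self, e.2.mul_self]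

theorem core_val (x : HClass e) : core e x.val = x := by
  refine HClass.ext ?_
  rw [val_core x.liesBelow, x.e_mul, x.mul_e]

theorem core_mul (hx : LiesBelow e.1 x) (hy : LiesBelow e.1 y) :
    core e (x * y) = core e x * core e y := by
  refine HClass.ext ?_
  rw [val_core ((liesBelow_mul e.2).2 ⟨hx, hy⟩), val_mul, val_core hx, val_core hy]
  have := mul_proj_comm_mul e.2 e.1 x (y * e.1)
  simp only [mul_assoc, e.2.mul_left_self] at this ⊢
  exact this

theorem core_add (hx : LiesBelow e.1 x) (hy : LiesBelow e.1 y) :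
    core e (x + y) = core e x + core e y := by
  refine HClass.ext ?_
  rw [val_core ((liesBelow_add e.2).2 ⟨hx, hy⟩), val_add, val_core hx, val_core hy,
    e.2.mul_add']
  simp only [e.2.mul_eq_add, e.2.mul_eq_add', add_assoc]

theorem core_star (hx : LiesBelow e.1 x) : core e (star x) = (core e x)⁻¹ := by
  refine HClass.ext ?_
  rw [val_core (liesBelow_star.2 hx), val_inv, val_core hx, star_mul_rev, star_mul_rev,
    e.2.star_eq, mul_assoc]

theorem core_neg (hx : LiesBelow e.1 x) : core e (-x) = -core e x := by
  refine HClass.ext ?_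
  rw [val_core (liesBelow_neg.2 hx), val_neg, val_core hx]
  simp only [e.2.mul_eq_add, e.2.mul_eq_add', neg_add_rev_self, e.2.neg_eq, add_assoc]

end HClass

/-- Elements are determined by their compressions, once they agree in their `𝒟`-class, given
by the projections `P` below it, and are both fixed by a common left and a common right factor. -/
theorem eq_of_core_eq {x y f g : S} {P : S → Prop} (hfx : f * x = x) (hfy : f * y = y)
    (hxg : x * g = x) (hyg : y * g = y)
    (hPx : ∀ e : S, IsProjection e → (LiesBelow e x ↔ P e))
    (hPy : ∀ e : S, IsProjection e → (LiesBelow e y ↔ P e))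
    (hcore : ∀ e : {e : S // IsProjection e}, P e → HClass.core e x = HClass.core e y) :
    x = y := by
  -- if the projection `e` generates the same `𝒟`-class as `w`, then `w` is recovered
  -- from `e * w * e` by multiplying with `f` and `g`
  have key : ∀ w e : S, IsProjection e → f * w = w → w * g = w →
      w * star w * e * (w * star w) = w * star w → f * (e * w * e) * g = w := by
    intro w e he hf hg h
    have hp := isProjection_mul_star w
    have h1 := mul_proj_comm_mul he (f * e) w g
    have h2 := mul_proj_comm_mul hp f e w
    have h3 : w * star w * (e * w) = w := by
      conv_rhs => rw [← mul_star_mul_self w, ← h, mul_assoc, mul_star_mul_self, mul_assoc]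
    rw [mul_star_mul_self, h3, hf] at h2
    simp only [mul_assoc, he.mul_left_self] at h1 ⊢
    rw [← h1, hg, ← h2]
  have he := isProjection_mul_star x
  have hP := (hPx _ he).1 (liesBelow_self x)
  have hy := (hPy _ he).2 hP
  have hyx : LiesBelow (y * star y) (x * star x) := by
    have hy' := isProjection_mul_star y
    have := (hPx _ hy').2 ((hPy _ hy').1 (liesBelow_self y))
    rw [liesBelow_mul hy', liesBelow_star]
    exact ⟨this, this⟩
  have h := congrArg HClass.val (hcore ⟨_, he⟩ hP)
  rw [HClass.val_core (liesBelow_self x), HClass.val_core hy] at h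
  rw [← key x _ he hfx hxg (by rw [he.mul_self, he.mul_self]), h]
  refine key y _ he hfy hyg ?_
  rwa [LiesBelow, he.star_eq, he.mul_self] at hyx

end HClass

section YangBaxter

/-! ### The deformed maps -/

variable {S : Type*} [DualWeakLeftStarBrace S]

open RegularStarSemigroup

/-- The first component of `checkDeformedMap`. -/
def checkFst (z a b : S) : S := (a * b + -(a * z) + z) * (z * star z)

/-- The first component of `deformedMap`. -/
def deformedFst (z a b : S) : S := star z * z * (-(a * z) + a * b * z) * (star z * z)

theorem checkDeformedMap_apply (z a b : S) :
    checkDeformedMap z (a, b) = (checkFst z a b, star (checkFst z a b) * (a * b)) := rfl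

theorem deformedMap_apply (z a b : S) :
    deformedMap z (a, b) = (deformedFst z a b, star (deformedFst z a b) * (a * b)) := rfl

variable {z a b : S}

theorem liesBelow_checkFst {e : S} (he : IsProjection e) :
    LiesBelow e (checkFst z a b) ↔ LiesBelow e a ∧ LiesBelow e b ∧ LiesBelow e z := by
  simp only [checkFst, liesBelow_mul he, liesBelow_add he, liesBelow_neg, liesBelow_star]
  tauto

theorem liesBelow_deformedFst {e : S} (he : IsProjection e) :
    LiesBelow e (deformedFst z a b) ↔ LiesBelow e a ∧ LiesBelow e b ∧ LiesBelow e z := by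
  simp only [deformedFst, liesBelow_mul he, liesBelow_add he, liesBelow_neg, liesBelow_star]
  tauto

theorem checkFst_mul_proj (z a b : S) :
    checkFst z a b * (z * star z) = checkFst z a b := by
  rw [checkFst, mul_assoc, (isProjection_mul_star z).mul_self]

/-- The left factor `z * star z` is absorbed because left multiplication by a projection is
right addition of it, and `z + z * star z = z`. -/
theorem proj_mul_checkFst (z a b : S) : z * star z * checkFst z a b = checkFst z a b := by
  have hp := isProjection_mul_star z
  rw [checkFst, hp.mul_eq_add', hp.mul_eq_add, add_assoc, add_assoc, add_mul_star]

theorem proj_mul_star_checkFst (z a b : S) :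
    z * star z * star (checkFst z a b) = star (checkFst z a b) := by
  have hp := isProjection_mul_star z
  rw [checkFst, star_mul_rev, hp.star_eq, hp.mul_left_self]

theorem deformedFst_mul_proj (z a b : S) :
    deformedFst z a b * (star z * z) = deformedFst z a b := by
  rw [deformedFst, mul_assoc, (isProjection_star_mul z).mul_self]

theorem proj_mul_deformedFst (z a b : S) :
    star z * z * deformedFst z a b = deformedFst z a b := by
  rw [deformedFst, mul_assoc (star z * z), (isProjection_star_mul z).mul_left_self]

theorem proj_mul_star_deformedFst (z a b : S) :
    star z * z * star (deformedFst z a b) = star (deformedFst z a b) := by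
  have hq := isProjection_star_mul z
  rw [deformedFst, star_mul_rev, hq.star_eq, hq.mul_left_self]

theorem proj_mul_checkFst_star (z a b : S) :
    star z * z * checkFst (star z) a b = checkFst (star z) a b := by
  simpa only [star_star_self] using proj_mul_checkFst (star z) a b

theorem checkFst_star_mul_proj (z a b : S) :
    checkFst (star z) a b * (star z * z) = checkFst (star z) a b := by
  simpa only [star_star_self] using checkFst_mul_proj (star z) a b

theorem proj_mul_star_checkFst_star (z a b : S) :
    star z * z * star (checkFst (star z) a b) = star (checkFst (star z) a b) := by
  simpa only [star_star_self] using proj_mul_star_checkFst (star z) a b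

section Core

variable {e : {e : S // IsProjection e}}

open HClass

theorem core_checkFst (ha : LiesBelow e.1 a) (hb : LiesBelow e.1 b) (hz : LiesBelow e.1 z) :
    core e (checkFst z a b) = deformedAct (core e z) (core e a) (core e b) := by
  simp only [checkFst, core_mul, core_add, core_neg, core_star, liesBelow_mul e.2,
    liesBelow_add e.2, liesBelow_neg, liesBelow_star, ha, hb, hz, and_self, deformedAct,
    mul_inv_cancel, mul_one]

theorem core_deformedFst (ha : LiesBelow e.1 a) (hb : LiesBelow e.1 b)
    (hz : LiesBelow e.1 z) :
    core e (deformedFst z a b) =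
      -(core e a * core e z) + core e a * core e b * core e z := by
  simp only [deformedFst, core_mul, core_add, core_neg, core_star, liesBelow_mul e.2,
    liesBelow_add e.2, liesBelow_neg, liesBelow_star, ha, hb, hz, and_self,
    inv_mul_cancel, mul_one, one_mul]

theorem isRightDistributor_core (hz : z ∈ rightDistributors S) (h : LiesBelow e.1 z) :
    IsRightDistributor (core e z) := by
  intro x y
  have h1 := congrArg (core e) (hz x.val y.val)
  simpa only [core_add, core_mul, core_neg, core_val, liesBelow_add e.2, liesBelow_mul e.2,
    liesBelow_neg, h, x.liesBelow, y.liesBelow, and_self] using h1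

end Core

open HClass

theorem isYangBaxterSolution_checkDeformedMap (hz : z ∈ rightDistributors S) :
    IsYangBaxterSolution (checkDeformedMap z) := by
  funext ⟨a, b, c⟩
  simp only [Function.comp, actLeft, actRight, checkDeformedMap_apply]
  let P : S → Prop := fun e => LiesBelow e a ∧ LiesBelow e b ∧ LiesBelow e c ∧ LiesBelow e z
  have hYB : ∀ e : {e : S // IsProjection e}, P e → _ := fun e h =>
    deformedAct_yangBaxter (a := core e a) (b := core e b) (c := core e c)
      (isSkewLeftBrace (e := e)) (isRightDistributor_core hz h.2.2.2) rfl rfl rfl rfl rfl rfl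
  refine Prod.ext (eq_of_core_eq (P := P) (f := z * star z) (g := z * star z)
      (proj_mul_checkFst z _ _) (proj_mul_checkFst z _ _) (checkFst_mul_proj z _ _)
      (checkFst_mul_proj z _ _) (fun e he => ?_) (fun e he => ?_) (fun e h => ?_))
    (Prod.ext (eq_of_core_eq (P := P) (f := z * star z) (g := z * star z) ?_
        (proj_mul_checkFst z _ _) ?_ (checkFst_mul_proj z _ _) (fun e he => ?_)
        (fun e he => ?_) (fun e h => ?_))
      (eq_of_core_eq (P := P) (f := z * star z) (g := star c * c) ?_ ?_ ?_ ?_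
        (fun e he => ?_) (fun e he => ?_) (fun e h => ?_)))
  case refine_3 =>
    obtain ⟨ha, hb, hc, hz'⟩ := id h
    simp only [core_mul, core_star, core_checkFst, liesBelow_mul e.2, liesBelow_star,
      liesBelow_checkFst e.2, ha, hb, hc, hz', and_self]
    exact (hYB e h).1
  case refine_8 =>
    obtain ⟨ha, hb, hc, hz'⟩ := id h
    simp only [core_mul, core_star, core_checkFst, liesBelow_mul e.2, liesBelow_star,
      liesBelow_checkFst e.2, ha, hb, hc, hz', and_self]
    exact (hYB e h).2.1
  case refine_15 =>
    obtain ⟨ha, hb, hc, hz'⟩ := id h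
    simp only [core_mul, core_star, core_checkFst, liesBelow_mul e.2, liesBelow_star,
      liesBelow_checkFst e.2, ha, hb, hc, hz', and_self]
    exact (hYB e h).2.2
  case refine_4 => rw [← mul_assoc, proj_mul_star_checkFst]
  case refine_5 => rw [mul_assoc, mul_assoc _ _ (z * star z), checkFst_mul_proj]
  case refine_9 => rw [← mul_assoc, proj_mul_star_checkFst]
  case refine_10 => rw [← mul_assoc, proj_mul_star_checkFst]
  case refine_11 => simp only [mul_assoc, mul_star_mul_self_assoc]
  case refine_12 => simp only [mul_assoc, mul_star_mul_self_assoc]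
  all_goals
    simp only [P, liesBelow_mul he, liesBelow_star, liesBelow_checkFst he]
    tauto

theorem deformedMap_comp_checkDeformedMap_comp_deformedMap (hz : z ∈ rightDistributors S) :
    deformedMap z ∘ checkDeformedMap (star z) ∘ deformedMap z = deformedMap z := by
  funext ⟨a, b⟩
  simp only [Function.comp, deformedMap_apply, checkDeformedMap_apply]
  let P : S → Prop := fun e => LiesBelow e a ∧ LiesBelow e b ∧ LiesBelow e z
  refine Prod.ext (eq_of_core_eq (P := P) (f := star z * z) (g := star z * z)
      (proj_mul_deformedFst z _ _) (proj_mul_deformedFst z _ _) (deformedFst_mul_proj z _ _)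
      (deformedFst_mul_proj z _ _) (fun e he => ?_) (fun e he => ?_) (fun e h => ?_))
    (eq_of_core_eq (P := P) (f := star z * z) (g := star b * b) ?_ ?_ ?_ ?_
      (fun e he => ?_) (fun e he => ?_) (fun e h => ?_))
  case refine_3 | refine_10 =>
    obtain ⟨ha, hb, hz'⟩ := h
    have hG := isSkewLeftBrace (e := e)
    have hd := isRightDistributor_core hz hz'
    simp only [core_mul, core_star, core_checkFst, core_deformedFst, liesBelow_mul e.2,
      liesBelow_star, liesBelow_checkFst e.2, liesBelow_deformedFst e.2, ha, hb, hz', and_self,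
      mul_inv_cancel_left, deformedAct_inv_opposite hG hd]
  case refine_4 => rw [← mul_assoc, proj_mul_star_deformedFst]
  case refine_5 => rw [← mul_assoc, proj_mul_star_deformedFst]
  case refine_6 => simp only [mul_assoc, mul_star_mul_self_assoc]
  case refine_7 => simp only [mul_assoc, mul_star_mul_self_assoc]
  all_goals
    simp only [P, liesBelow_mul he, liesBelow_star, liesBelow_checkFst he,
      liesBelow_deformedFst he] <;> tauto

theorem checkDeformedMap_comp_deformedMap_comp_checkDeformedMap
    (hz : z ∈ rightDistributors S) :
    checkDeformedMap (star z) ∘ deformedMap z ∘ checkDeformedMap (star z) =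
      checkDeformedMap (star z) := by
  funext ⟨a, b⟩
  simp only [Function.comp, deformedMap_apply, checkDeformedMap_apply]
  let P : S → Prop := fun e => LiesBelow e a ∧ LiesBelow e b ∧ LiesBelow e z
  refine Prod.ext (eq_of_core_eq (P := P) (f := star z * z) (g := star z * z)
      (proj_mul_checkFst_star z _ _) (proj_mul_checkFst_star z _ _)
      (checkFst_star_mul_proj z _ _) (checkFst_star_mul_proj z _ _)
      (fun e he => ?_) (fun e he => ?_) (fun e h => ?_))
    (eq_of_core_eq (P := P) (f := star z * z) (g := star b * b) ?_ ?_ ?_ ?_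
      (fun e he => ?_) (fun e he => ?_) (fun e h => ?_))
  case refine_3 | refine_10 =>
    obtain ⟨ha, hb, hz'⟩ := h
    have hG := isSkewLeftBrace (e := e)
    have hd := isRightDistributor_core hz hz'
    simp only [core_mul, core_star, core_checkFst, core_deformedFst, liesBelow_mul e.2,
      liesBelow_star, liesBelow_checkFst e.2, liesBelow_deformedFst e.2, ha, hb, hz', and_self,
      mul_inv_cancel_left, inv_mul_cancel_left, opposite_deformedAct_inv hG hd]
  case refine_4 => rw [← mul_assoc, proj_mul_star_checkFst_star]
  case refine_5 => rw [← mul_assoc, proj_mul_star_checkFst_star]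
  case refine_6 => simp only [mul_assoc, mul_star_mul_self_assoc]
  case refine_7 => simp only [mul_assoc, mul_star_mul_self_assoc]
  all_goals
    simp only [P, liesBelow_mul he, liesBelow_star, liesBelow_checkFst he,
      liesBelow_deformedFst he] <;> tauto

theorem deformedMap_comp_checkDeformedMap_comm (hz : z ∈ rightDistributors S) :
    deformedMap z ∘ checkDeformedMap (star z) = checkDeformedMap (star z) ∘ deformedMap z := by
  funext ⟨a, b⟩
  simp only [Function.comp, deformedMap_apply, checkDeformedMap_apply]
  let P : S → Prop := fun e => LiesBelow e a ∧ LiesBelow e b ∧ LiesBelow e z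
  refine Prod.ext (eq_of_core_eq (P := P) (f := star z * z) (g := star z * z)
      (proj_mul_deformedFst z _ _) (proj_mul_checkFst_star z _ _)
      (deformedFst_mul_proj z _ _) (checkFst_star_mul_proj z _ _)
      (fun e he => ?_) (fun e he => ?_) (fun e h => ?_))
    (eq_of_core_eq (P := P) (f := star z * z) (g := star b * b) ?_ ?_ ?_ ?_
      (fun e he => ?_) (fun e he => ?_) (fun e h => ?_))
  case refine_3 | refine_10 =>
    obtain ⟨ha, hb, hz'⟩ := h
    have hG := isSkewLeftBrace (e := e)
    have hd := isRightDistributor_core hz hz'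
    -- both composites become the identity of pairs in a skew left brace
    simp only [core_mul, core_star, core_checkFst, core_deformedFst, liesBelow_mul e.2,
      liesBelow_star, liesBelow_checkFst e.2, liesBelow_deformedFst e.2, ha, hb, hz', and_self,
      mul_inv_cancel_left, opposite_deformedAct_inv hG hd, deformedAct_inv_opposite hG hd]
  case refine_4 => rw [← mul_assoc, proj_mul_star_deformedFst]
  case refine_5 => rw [← mul_assoc, proj_mul_star_checkFst_star]
  case refine_6 => simp only [mul_assoc, mul_star_mul_self_assoc]
  case refine_7 => simp only [mul_assoc, mul_star_mul_self_assoc]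
  all_goals
    simp only [P, liesBelow_mul he, liesBelow_star, liesBelow_checkFst he,
      liesBelow_deformedFst he]
    tauto

end YangBaxter

theorem theorem4p7 {S : Type*} [DualWeakLeftStarBrace S] (z : S)
    (hz : z ∈ rightDistributors S) :
    IsYangBaxterSolution (checkDeformedMap z) ∧
    deformedMap z ∘ checkDeformedMap (star z) ∘ deformedMap z = deformedMap z ∧
    checkDeformedMap (star z) ∘ deformedMap z ∘ checkDeformedMap (star z) =
      checkDeformedMap (star z) ∧
    deformedMap z ∘ checkDeformedMap (star z) = checkDeformedMap (star z) ∘ deformedMap z :=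
  ⟨isYangBaxterSolution_checkDeformedMap hz,
    deformedMap_comp_checkDeformedMap_comp_deformedMap hz,
    checkDeformedMap_comp_deformedMap_comp_checkDeformedMap hz,
    deformedMap_comp_checkDeformedMap_comm hz⟩
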